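/- Let $(X,d)$ be a metric space equipped with a Borel measure $\mu$ such that every ball $B(x,r)=\{y: d(x,y)<r\}$, $r>0$, has positive and finite measure, and suppose that $\mu$ is doubling: there are constants $C_1>1$ and $n>0$ with $\mu(B(x,\lambda r))\le C_1\lambda^n\mu(B(x,r))$ for all $x\in X$, $r>0$ and $\lambda>1$. A nonnegative Borel function $g:X\to[0,\infty]$ is a *$p$-weak upper gradient* of $u:X\to\mathbb R$ if $|u(x)-u(y)|\le\int_\gamma g\,ds$ for all non-constant compact rectifiable curves $\gamma$ outside a family of $p$-modulus zero, where $x,y$ are the endpoints of $\gamma$; the $p$-modulus of a family $\Gamma$ of such curves is $\inf_\rho\int_X\rho^p\,d\mu$ over all Borel $\rho:X\to[0,\infty]$ with $\int_\gamma\rho\,ds\ge1$ for every $\gamma\in\Gamma$. The space $X$ supports a *weak $(1,p)$-Poincaré inequality* if there are constants $C>0$ and $\lambda>1$ such that for all real functions $u$ that are integrable on balls, all $p$-weak upper gradients $g$ of $u$ and all balls $B=B(x,r)$, with $\lambda B=B(x,\lambda r)$ and $u_B=\frac1{\mu(B)}\int_B u\,d\mu$, $$\frac1{\mu(B)}\int_B|u-u_B|\,d\mu\le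 C\,r\left(\frac1{\mu(\lambda B)}\int_{\lambda B}g^p\,d\mu\right)^{1/p}.$$ For a $\mu$-measurable $u:X\to\mathbb R$ let $\mathbb D^1(u)$ be the set of all sequences $\vec g=\{g_k\}_{k\in\mathbb Z}$ of nonnegative measurable functions for which there is $E\subset X$ with $\mu(E)=0$ such that $|u(x)-u(y)|\le d(x,y)\,[g_k(x)+g_k(y)]$ for all $k\in\mathbb Z$ and all $x,y\in X\setminus E$ with $2^{-k-1}\le d(x,y)<2^{-k}$. For $p,q\in(0,\infty)$ let $\dot N^1_{p,q}(X)$ be the space of all $\mu$-measurable $u:X\to\mathbb R$ with $$\inf_{\vec g\in\mathbb D^1(u)}\Big(\sum_{k\in\mathbb Z}\|g_k\|_{L^p(X)}^q\Big)^{1/q}<\infty,$$ and $\dot M^1_{p,q}(X)$ the space of all $\mu$-measurable $u:X\to\mathbb R$ with $$\inf_{\vec g\in\mathbb D^1(u)}\Big\|\Big(\sum_{k\in\mathbb Z}g_k^q\Big)^{1/q}\Big\|_{L^p(X)}<\infty.$$ **Theorem.** Let $1<p<\infty$ and suppose that $X$ supports a weak $(1,p)$-Poincaré inequality. Then for every $q\in(0,\infty)$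 the spaces $\dot N^1_{p,q}(X)$ and $\dot M^1_{p,q}(X)$ are trivial: each of their elements coincides $\mu$-almost everywhere with a constant function. -/

import Mathlib

open MeasureTheory Metric Set
open scoped ENNReal NNReal

/-- Standing assumptions on a Borel measure on a metric space: balls have positive and finite
measure, and the measure is doubling, `μ (B (x, t r)) ≤ C t ^ n μ (B (x, r))` for `t > 1`. -/
structure IsDoublingSpace {X : Type*} [MetricSpace X] [MeasurableSpace X] (μ : Measure X) :
    Prop where
  ball_pos : ∀ (x : X) (r : ℝ), 0 < r → 0 < μ (ball x r)
  ball_lt_top : ∀ (x : X) (r : ℝ), 0 < r → μ (ball x r) < ∞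
  doubling : ∃ C n : ℝ, 1 < C ∧ 0 < n ∧ ∀ (x : X) (r t : ℝ), 0 < r → 1 < t →
    μ (ball x (t * r)) ≤ ENNReal.ofReal (C * t ^ n) * μ (ball x r)

-- Hajlasz gradients and the function spaces

/-- `g = (g_k)`, `k ∈ ℤ`, is a fractional `s`-Hajlasz gradient of `u`: the functions `g_k` are
nonnegative and `μ`-measurable, and outside a `μ`-null set `E` one has
`|u x - u y| ≤ d(x, y) ^ s (g_k x + g_k y)` whenever `2 ^ (-k-1) ≤ d(x, y) < 2 ^ (-k)`. -/
def IsFracHajlaszGradient {X : Type*} [MetricSpace X] [MeasurableSpace X] (μ : Measure X)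
    (s : ℝ) (u : X → ℝ) (g : ℤ → X → ℝ≥0) : Prop :=
  (∀ k, AEMeasurable (g k) μ) ∧
    ∃ E : Set X, μ E = 0 ∧ ∀ (k : ℤ) (x y : X), x ∉ E → y ∉ E →
      (2 : ℝ) ^ (-k - 1) ≤ dist x y → dist x y < (2 : ℝ) ^ (-k) →
        |u x - u y| ≤ dist x y ^ s * ((g k x : ℝ) + (g k y : ℝ))

/-- The (quasi-)norm of `g` in `ℓ^q(L^p)`, `0 < p, q < ∞`: the `ℓ^q` norm over `k ∈ ℤ` of
`‖g_k‖_{L^p}`. -/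
noncomputable def lqLpNorm {X : Type*} [MeasurableSpace X] (μ : Measure X) (p q : ℝ)
    (g : ℤ → X → ℝ≥0) : ℝ≥0∞ :=
  (∑' k : ℤ, ((∫⁻ x, (g k x : ℝ≥0∞) ^ p ∂μ) ^ (1 / p)) ^ q) ^ (1 / q)

/-- The (quasi-)norm of `g` in `L^p(ℓ^q)`, `0 < p, q < ∞`: the `L^p` norm over `x` of
`‖(g_k x)_k‖_{ℓ^q}`. -/
noncomputable def lpLqNorm {X : Type*} [MeasurableSpace X] (μ : Measure X) (p q : ℝ)
    (g : ℤ → X → ℝ≥0) : ℝ≥0∞ :=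
  (∫⁻ x, ((∑' k : ℤ, (g k x : ℝ≥0∞) ^ q) ^ (1 / q)) ^ p ∂μ) ^ (1 / p)

/-- The homogeneous Hajlasz-Besov (quasi-)seminorm of `u` for `0 < p, q < ∞`
(it is `∞` if there is no gradient of finite norm). -/
noncomputable def hajlaszBesovSeminorm {X : Type*} [MetricSpace X] [MeasurableSpace X]
    (μ : Measure X) (s p q : ℝ) (u : X → ℝ) : ℝ≥0∞ :=
  ⨅ (g : ℤ → X → ℝ≥0) (_ : IsFracHajlaszGradient μ s u g), lqLpNorm μ p q g

/-- The homogeneous Hajlasz-Triebel-Lizorkin (quasi-)seminorm of `u` for `0 < p, q < ∞`. -/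
noncomputable def hajlaszTriebelLizorkinSeminorm {X : Type*} [MetricSpace X] [MeasurableSpace X]
    (μ : Measure X) (s p q : ℝ) (u : X → ℝ) : ℝ≥0∞ :=
  ⨅ (g : ℤ → X → ℝ≥0) (_ : IsFracHajlaszGradient μ s u g), lpLqNorm μ p q g

/-- The homogeneous Hajlasz-Besov space: all `μ`-measurable `u` with finite seminorm. -/
def hajlaszBesov {X : Type*} [MetricSpace X] [MeasurableSpace X] (μ : Measure X)
    (s p q : ℝ) : Set (X → ℝ) :=
  {u | AEMeasurable u μ ∧ hajlaszBesovSeminorm μ s p q u < ∞}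

/-- The homogeneous Hajlasz-Triebel-Lizorkin space: all `μ`-measurable real functions with
finite seminorm. -/
def hajlaszTriebelLizorkin {X : Type*} [MetricSpace X] [MeasurableSpace X] (μ : Measure X)
    (s p q : ℝ) : Set (X → ℝ) :=
  {u | AEMeasurable u μ ∧ hajlaszTriebelLizorkinSeminorm μ s p q u < ∞}

-- Rectifiable curves, modulus and upper gradients

/-- A non-constant compact rectifiable curve `[a, b] → X`. The function is defined on all of `ℝ`
for convenience; only its values on `[a, b]` matter. -/
structure RectCurve (X : Type*) [MetricSpace X] where
  a : ℝ
  b : ℝ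
  le : a ≤ b
  toFun : ℝ → X
  continuousOn : ContinuousOn toFun (Icc a b)
  rectifiable : eVariationOn toFun (Icc a b) ≠ ∞
  nonconstant : ∃ t ∈ Icc a b, toFun t ≠ toFun a

/-- The length of a rectifiable curve. -/
noncomputable def RectCurve.length {X : Type*} [MetricSpace X] (γ : RectCurve X) : ℝ :=
  (eVariationOn γ.toFun (Icc γ.a γ.b)).toReal

/-- The arc-length parametrization of the curve, used on `[0, length]`: its value at `t` is `γ`
at a parameter at which the length travelled from `a` is `t`. -/
noncomputable def RectCurve.arcLengthParam {X : Type*} [MetricSpace X] (γ : RectCurve X) :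
    ℝ → X :=
  naturalParameterization γ.toFun (Icc γ.a γ.b) γ.a

/-- The line integral `∫_γ g ds` with respect to arc length. -/
noncomputable def RectCurve.lineIntegral {X : Type*} [MetricSpace X] (γ : RectCurve X)
    (g : X → ℝ≥0∞) : ℝ≥0∞ :=
  ∫⁻ t in Icc 0 γ.length, g (γ.arcLengthParam t)

/-- The `p`-modulus of a family of curves: the infimum of `∫ ρ ^ p dμ` over all Borel functions
`ρ : X → [0, ∞]` with `∫_γ ρ ds ≥ 1` for each curve of the family. -/
noncomputable def curveModulus {X : Type*} [MetricSpace X] [MeasurableSpace X] (μ : Measure X)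
    (p : ℝ) (Γ : Set (RectCurve X)) : ℝ≥0∞ :=
  ⨅ (ρ : X → ℝ≥0∞) (_ : Measurable ρ ∧ ∀ γ ∈ Γ, 1 ≤ γ.lineIntegral ρ), ∫⁻ x, ρ x ^ p ∂μ

/-- `g` is a `p`-weak upper gradient of `u`: a nonnegative Borel function such that
`|u x - u y| ≤ ∫_γ g ds`, with `x`, `y` the endpoints of `γ`, for all non-constant compact
rectifiable curves `γ` outside a family of zero `p`-modulus. -/
def IsWeakUpperGradient {X : Type*} [MetricSpace X] [MeasurableSpace X] (μ : Measure X)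
    (p : ℝ) (u : X → ℝ) (g : X → ℝ≥0∞) : Prop :=
  Measurable g ∧ ∃ Γ : Set (RectCurve X), curveModulus μ p Γ = 0 ∧
    ∀ γ : RectCurve X, γ ∉ Γ →
      ENNReal.ofReal |u (γ.toFun γ.a) - u (γ.toFun γ.b)| ≤ γ.lineIntegral g

/-- The weak `(1, p)`-Poincare inequality: with constants `C > 0` and `t > 1`,
`⨍_B |u - u_B| dμ ≤ C r (⨍_{t B} g ^ p dμ) ^ (1 / p)` for all balls `B` of radius `r > 0`, all
functions `u` integrable on balls and all `p`-weak upper gradients `g` of `u`. -/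
def SupportsWeakPoincare {X : Type*} [MetricSpace X] [MeasurableSpace X] (μ : Measure X)
    (p : ℝ) : Prop :=
  ∃ C t : ℝ, 0 < C ∧ 1 < t ∧
    ∀ (u : X → ℝ) (g : X → ℝ≥0∞), (∀ (y : X) (R : ℝ), IntegrableOn u (ball y R) μ) →
      IsWeakUpperGradient μ p u g → ∀ (x : X) (r : ℝ), 0 < r →
        ⨍⁻ z in ball x r, ENNReal.ofReal |u z - ⨍ w in ball x r, u w ∂μ| ∂μ ≤
          ENNReal.ofReal (C * r) * (⨍⁻ z in ball x (t * r), g z ^ p ∂μ) ^ (1 / p)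

/-! ### Arc-length parametrization and upper gradients from difference quotients -/

section Curves

open Filter Topology

/-! At smoothness `s = 1` the Hajłasz inequality controls difference quotients at every scale, while
summability in `k` forces `‖g_k‖_p → 0` as `k → ∞`. So `u` has difference quotients at small scales
that are arbitrarily small in `L^p`, and the Poincaré inequality turns this into constancy.

After passing to `arctan u`, the function is bounded. The tail `G = weightedTail p g k` satisfies
`|u x - u y| ≤ 2^(-k) (G x + G y)` whenever `d(x, y) < 2^(-k)`, and `∫ G^p ≤ 2 sup_{m ≥ k} ∫ g_m^p`
is small (`enorm_sub_le_weightedTail`, `lintegral_weightedTail_rpow_le`).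

Such a `G` is not an upper gradient, so `u` is replaced by its tent average `v` at scale `r =
2^(-k)/8`. Then `v` is continuous, and a constant times the ball average `A` of `G` is an upper
gradient of `v` (`enorm_tentAverage_sub_tentAverage_le_ballAverage`,
`isWeakUpperGradient_of_dist_lt`). Moreover `|u - v|` is at most a constant times `r (A + G)` almost
everywhere, and averaging is bounded on `L^p` uniformly in `r`.

Poincaré for `v` on a fixed ball thus gives `∫ |u - c| ≤ K ‖G‖_p` with `K` independent of `k`.
Letting `k → ∞` makes `u` constant on every ball. -/

/-- The one-sided jumps of the variation function are the distances from `f b` to the one-sided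
limits of `f`, hence zero where `f` is continuous. -/
theorem continuousOn_variationOnFromTo {E : Type*} [PseudoMetricSpace E] {f : ℝ → E} {s : Set ℝ}
    {a : ℝ} (ha : a ∈ s) (hf : LocallyBoundedVariationOn f s) (hc : ContinuousOn f s) :
    ContinuousOn (variationOnFromTo f s a) s := by
  intro b hb
  have hl := variationOnFromTo.tendsto_left ha hb hf ((hc b hb).mono inter_subset_left)
  have hr := variationOnFromTo.tendsto_right ha hb hf ((hc b hb).mono inter_subset_left)
  rw [dist_self, sub_zero] at hl
  rw [dist_self, add_zero] at hr
  have h : ContinuousWithinAt (variationOnFromTo f s a)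
      (insert b ((s ∩ Iio b) ∪ (s ∩ Ioi b))) b :=
    continuousWithinAt_insert_self.2 (ContinuousWithinAt.union hl hr)
  refine h.mono fun x hx => ?_
  rcases lt_trichotomy x b with h | h | h
  · exact Or.inr (Or.inl ⟨hx, h⟩)
  · exact Or.inl h
  · exact Or.inr (Or.inr ⟨hx, h⟩)

namespace RectCurve

variable {X : Type*} [MetricSpace X] (γ : RectCurve X)

theorem locallyBoundedVariationOn :
    LocallyBoundedVariationOn γ.toFun (Icc γ.a γ.b) :=
  BoundedVariationOn.locallyBoundedVariationOn γ.rectifiable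

theorem left_mem : γ.a ∈ Icc γ.a γ.b := ⟨le_rfl, γ.le⟩

theorem right_mem : γ.b ∈ Icc γ.a γ.b := ⟨γ.le, le_rfl⟩

theorem length_nonneg : 0 ≤ γ.length := ENNReal.toReal_nonneg

theorem variationOnFromTo_right :
    variationOnFromTo γ.toFun (Icc γ.a γ.b) γ.a γ.b = γ.length := by
  rw [variationOnFromTo.eq_of_le _ _ γ.le, inter_self, length]

theorem image_variationOnFromTo :
    variationOnFromTo γ.toFun (Icc γ.a γ.b) γ.a '' Icc γ.a γ.b = Icc 0 γ.length := by
  have hm := variationOnFromTo.monotoneOn γ.locallyBoundedVariationOn γ.left_mem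
  apply Subset.antisymm
  · rintro _ ⟨t, ht, rfl⟩
    refine ⟨variationOnFromTo.nonneg_of_le _ _ ht.1, ?_⟩
    rw [← variationOnFromTo_right]
    exact hm ht γ.right_mem ht.2
  · have := intermediate_value_Icc γ.le (continuousOn_variationOnFromTo γ.left_mem
      γ.locallyBoundedVariationOn γ.continuousOn)
    rwa [variationOnFromTo.self, variationOnFromTo_right] at this

theorem arcLengthParam_zero : γ.arcLengthParam 0 = γ.toFun γ.a := by
  have := edist_naturalParameterization_eq_zero γ.locallyBoundedVariationOn γ.left_mem γ.left_mem
  rw [variationOnFromTo.self] at this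
  exact edist_eq_zero.1 this

theorem arcLengthParam_length : γ.arcLengthParam γ.length = γ.toFun γ.b := by
  have := edist_naturalParameterization_eq_zero γ.locallyBoundedVariationOn γ.left_mem γ.right_mem
  rw [variationOnFromTo_right] at this
  exact edist_eq_zero.1 this

/-- The parametrization has unit speed, and a distance never exceeds the variation in between. -/
theorem lipschitzOnWith_arcLengthParam :
    LipschitzOnWith 1 γ.arcLengthParam (Icc 0 γ.length) := by
  have h := has_unit_speed_naturalParameterization γ.toFun γ.locallyBoundedVariationOn γ.left_mem
  rw [image_variationOnFromTo] at h
  intro x hx y hy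
  wlog hxy : x ≤ y generalizing x y
  · rw [edist_comm, edist_comm x]
    exact this hy hx (le_of_not_ge hxy)
  have h1 := h hx hy
  calc edist (γ.arcLengthParam x) (γ.arcLengthParam y)
      ≤ eVariationOn γ.arcLengthParam (Icc 0 γ.length ∩ Icc x y) :=
        eVariationOn.edist_le _ ⟨hx, le_rfl, hxy⟩ ⟨hy, hxy, le_rfl⟩
    _ = ENNReal.ofReal (y - x) := by
        rw [arcLengthParam, h1, NNReal.coe_one, one_mul]
    _ = (1 : ℝ≥0) * edist x y := by
        rw [edist_comm, edist_dist, Real.dist_eq, abs_of_nonneg (sub_nonneg.2 hxy),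
          ENNReal.coe_one, one_mul]

end RectCurve

/-- No derivative of `f` is needed: integrating `f (t + δ) - f t` over `[0, L]` leaves only averages
of `f` near the two ends, which converge to the end values as `δ → 0`. -/
theorem ofReal_abs_sub_le_lintegral_of_difference_quotient {f : ℝ → ℝ} {ρ : ℝ → ℝ≥0∞} {L r : ℝ}
    (hL : 0 ≤ L) (hr : 0 < r) (hf : Continuous f) (hfL : ∀ x, L ≤ x → f x = f L)
    (h : ∀ t ∈ Icc 0 L, ∀ δ : ℝ, 0 < δ → δ < r →
      ENNReal.ofReal |f (t + δ) - f t| ≤ ENNReal.ofReal δ * ρ t) :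
    ENNReal.ofReal |f 0 - f L| ≤ ∫⁻ t in Icc 0 L, ρ t := by
  have hint : ∀ a b : ℝ, IntervalIntegrable f volume a b := fun a b => hf.intervalIntegrable a b
  have key : ∀ δ : ℝ, 0 < δ → δ < r →
      ENNReal.ofReal |δ⁻¹ • (∫ t in (0 : ℝ)..δ, f t) - f L| ≤ ∫⁻ t in Icc 0 L, ρ t := by
    intro δ hδ hδr
    -- The integral telescopes; past `L` the function is frozen at `f L`.
    have h1 : ∫ t in (0 : ℝ)..L, (f (t + δ) - f t) = δ * f L - ∫ t in (0 : ℝ)..δ, f t := by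
      rw [intervalIntegral.integral_sub
        (Continuous.intervalIntegrable (by fun_prop) _ _) (hint _ _),
        intervalIntegral.integral_comp_add_right, zero_add]
      have h2 : ∫ t in L..(L + δ), f t = δ * f L := by
        rw [intervalIntegral.integral_congr (g := fun _ => f L)]
        · simp
        · intro x hx
          rw [uIcc_of_le (by linarith)] at hx
          exact hfL x hx.1
      have h3 := intervalIntegral.integral_add_adjacent_intervals (hint 0 L) (hint L (L + δ))
      have h4 := intervalIntegral.integral_add_adjacent_intervals (hint 0 δ) (hint δ (L + δ))
      linarith
    have h2 : ENNReal.ofReal |∫ t in (0 : ℝ)..L, (f (t + δ) - f t)| ≤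
        ENNReal.ofReal δ * ∫⁻ t in Icc 0 L, ρ t := by
      rw [intervalIntegral.integral_of_le hL, ← Real.enorm_eq_ofReal_abs,
        ← lintegral_const_mul' _ _ ENNReal.ofReal_ne_top]
      refine (enorm_integral_le_lintegral_enorm _).trans ?_
      refine (lintegral_mono_set Ioc_subset_Icc_self).trans ?_
      refine setLIntegral_mono' measurableSet_Icc fun t ht => ?_
      rw [Real.enorm_eq_ofReal_abs]
      exact h t ht δ hδ hδr
    have h3 : |δ⁻¹ • (∫ t in (0 : ℝ)..δ, f t) - f L| =
        δ⁻¹ * |∫ t in (0 : ℝ)..L, (f (t + δ) - f t)| := by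
      rw [h1, abs_sub_comm, ← abs_of_pos (inv_pos.2 hδ), ← abs_mul, abs_of_pos (inv_pos.2 hδ),
        mul_sub, inv_mul_cancel_left₀ hδ.ne', smul_eq_mul]
    rw [h3, ENNReal.ofReal_mul (inv_pos.2 hδ).le, ENNReal.ofReal_inv_of_pos hδ,
      ENNReal.inv_mul_le_iff (by simpa using hδ) ENNReal.ofReal_ne_top]
    exact h2
  have hder : HasDerivAt (fun x => ∫ t in (0 : ℝ)..x, f t) (f 0) 0 :=
    intervalIntegral.integral_hasDerivAt_right (hint _ _)
      (hf.stronglyMeasurableAtFilter _ _) hf.continuousAt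
  have hlim : Tendsto (fun δ : ℝ => δ⁻¹ • (∫ t in (0 : ℝ)..δ, f t)) (𝓝[>] 0) (𝓝 (f 0)) := by
    have := hder.tendsto_slope_zero_right
    simpa using this
  have hlim2 : Tendsto (fun δ : ℝ => ENNReal.ofReal |δ⁻¹ • (∫ t in (0 : ℝ)..δ, f t) - f L|)
      (𝓝[>] 0) (𝓝 (ENNReal.ofReal |f 0 - f L|)) :=
    ENNReal.tendsto_ofReal ((hlim.sub_const _).abs)
  refine le_of_tendsto hlim2 ?_
  filter_upwards [Ioo_mem_nhdsGT hr] with δ hδ using key δ hδ.1 hδ.2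

theorem curveModulus_empty {X : Type*} [MetricSpace X] [MeasurableSpace X] (μ : Measure X)
    {p : ℝ} (hp : 0 < p) : curveModulus μ p (∅ : Set (RectCurve X)) = 0 := by
  refine le_antisymm ?_ zero_le
  refine (iInf₂_le (fun _ => 0) ⟨measurable_const, by simp⟩).trans ?_
  simp [ENNReal.zero_rpow_of_pos hp]

/-- The bound involves `ρ` at one endpoint only, so along an arc-length parametrized curve it bounds
forward difference quotients. It holds on every curve, so the exceptional family is empty. -/
theorem isWeakUpperGradient_of_dist_lt {X : Type*} [MetricSpace X] [MeasurableSpace X]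
    (μ : Measure X) {p r : ℝ} (hp : 0 < p) (hr : 0 < r) {v : X → ℝ} {ρ : X → ℝ≥0∞}
    (hρ : Measurable ρ) (hv : Continuous v)
    (h : ∀ x y, dist x y < r → ENNReal.ofReal |v x - v y| ≤ ENNReal.ofReal (dist x y) * ρ x) :
    IsWeakUpperGradient μ p v ρ := by
  refine ⟨hρ, ∅, curveModulus_empty μ hp, fun γ _ => ?_⟩
  have hL := γ.length_nonneg
  have hlip := γ.lipschitzOnWith_arcLengthParam
  set c : ℝ → X := γ.arcLengthParam with hc
  -- Clamping the parameter to `[0, length]` extends the function continuously, constant beyond the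
  -- ends.
  set f : ℝ → ℝ := fun t => v (c (projIcc 0 γ.length hL t)) with hf
  have hfI : ∀ t ∈ Icc 0 γ.length, f t = v (c t) := by
    intro t ht
    simp only [hf, projIcc_of_mem hL ht]
  have hcont : Continuous f := by
    have h1 : Continuous fun t : Icc 0 γ.length => c t :=
      continuousOn_iff_continuous_domRestrict.1 hlip.continuousOn
    exact hv.comp (h1.comp continuous_projIcc)
  have key := ofReal_abs_sub_le_lintegral_of_difference_quotient (f := f) (ρ := fun t => ρ (c t))
    hL hr hcont (fun x hx => by simp only [hf, projIcc_of_right_le hL hx, projIcc_right]) ?_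
  · rw [hfI 0 ⟨le_rfl, hL⟩, hfI _ ⟨hL, le_rfl⟩, hc, γ.arcLengthParam_zero,
      γ.arcLengthParam_length] at key
    exact key
  · intro t ht δ hδ hδr
    set t' : Icc 0 γ.length := projIcc 0 γ.length hL (t + δ) with ht'
    have hd : dist (c t) (c t') ≤ δ := by
      have h1 := hlip.dist_le_mul t ht t' t'.2
      rw [NNReal.coe_one, one_mul] at h1
      refine h1.trans ?_
      have h2 : (t' : ℝ) = max 0 (min γ.length (t + δ)) := by simp [ht', projIcc]
      rw [h2, Real.dist_eq, abs_le]
      rcases ht with ⟨h0, h1⟩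
      rw [max_eq_right (le_min hL (by linarith))]
      constructor <;> rcases min_cases γ.length (t + δ) with h | h <;> linarith
    rw [hfI t ht, abs_sub_comm]
    refine (h (c t) (c t') (hd.trans_lt hδr)).trans ?_
    gcongr

end Curves

/-! ### Hölder's inequality, doubling measures and ball averages -/

theorem rpow_setLIntegral_le {X : Type*} [MeasurableSpace X] {μ : Measure X} {p : ℝ}
    (hp : 1 < p) {G : X → ℝ≥0∞} (hG : Measurable G) (S : Set X) :
    (∫⁻ y in S, G y ∂μ) ^ p ≤ μ S ^ (p - 1) * ∫⁻ y in S, G y ^ p ∂μ := by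
  have hpq := Real.HolderConjugate.conjExponent hp
  have h := ENNReal.lintegral_mul_le_Lp_mul_Lq (μ.restrict S) hpq hG.aemeasurable
    (aemeasurable_const (b := (1 : ℝ≥0∞)))
  simp only [Pi.mul_apply, mul_one, ENNReal.one_rpow, lintegral_const, one_mul,
    Measure.restrict_apply_univ] at h
  have hp0 : 0 < p := by linarith
  calc (∫⁻ y in S, G y ∂μ) ^ p
      ≤ ((∫⁻ y in S, G y ^ p ∂μ) ^ (1 / p) * μ S ^ (1 / p.conjExponent)) ^ p := by
        gcongr
    _ = μ S ^ (p - 1) * ∫⁻ y in S, G y ^ p ∂μ := by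
        rw [ENNReal.mul_rpow_of_nonneg _ _ hp0.le, ← ENNReal.rpow_mul, ← ENNReal.rpow_mul,
          one_div_mul_cancel hp0.ne', ENNReal.rpow_one, mul_comm]
        congr 2
        rw [Real.conjExponent]
        have : p - 1 ≠ 0 := by linarith
        field_simp

section Doubling

variable {X : Type*} [MetricSpace X] [MeasurableSpace X] {μ : Measure X}

namespace IsDoublingSpace

/-- Factor `4` suffices below: every ball compared with some `B(x, r)` lies in `B(x, 4 r)`. -/
theorem exists_measure_ball_four_mul_le (hμ : IsDoublingSpace μ) :
    ∃ D : ℝ≥0∞, D ≠ ∞ ∧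
      ∀ (x : X) (r : ℝ), 0 < r → μ (ball x (4 * r)) ≤ D * μ (ball x r) := by
  obtain ⟨C, n, -, -, h⟩ := hμ.doubling
  refine ⟨ENNReal.ofReal (C * 4 ^ n), ENNReal.ofReal_ne_top,
    fun x r hr => h x r 4 hr (by norm_num)⟩

theorem measure_ball_ne_zero (hμ : IsDoublingSpace μ) (x : X) {r : ℝ} (hr : 0 < r) :
    μ (ball x r) ≠ 0 := (hμ.ball_pos x r hr).ne'

theorem measure_ball_ne_top (hμ : IsDoublingSpace μ) (x : X) (r : ℝ) :
    μ (ball x r) ≠ ∞ :=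
  ((measure_mono (ball_subset_ball (le_max_left r 1))).trans_lt
    (hμ.ball_lt_top x (max r 1) (by positivity))).ne

theorem sigmaFinite (hμ : IsDoublingSpace μ) : SigmaFinite μ := by
  rcases isEmpty_or_nonempty X with hX | ⟨⟨x⟩⟩
  · rw [Measure.eq_zero_of_isEmpty μ]
    infer_instance
  · exact ⟨⟨⟨fun n => ball x n, fun _ => trivial,
      fun n => (hμ.measure_ball_ne_top x n).lt_top, iUnion_ball_nat x⟩⟩⟩

/-- The balls of radius `ε / 2` around a maximal `ε`-separated set are disjoint with positive
measure, hence countably many by σ-finiteness. Second countability makes the distance measurable on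
the product, as Tonelli's theorem requires. -/
theorem secondCountableTopology [BorelSpace X] (hμ : IsDoublingSpace μ) :
    SecondCountableTopology X := by
  have := hμ.sigmaFinite
  refine secondCountable_of_almost_dense_set fun ε hε => ?_
  obtain ⟨s, hs⟩ := zorn_subset {s : Set X | s.Pairwise fun x y => ε ≤ dist x y} (by
    intro c hc hchain
    exact ⟨⋃₀ c, (pairwise_sUnion hchain.directedOn).2 fun t ht => hc ht,
      fun t ht => subset_sUnion_of_mem ht⟩)
  refine ⟨s, ?_, fun x => ?_⟩
  · have hdisj : Pairwise (Function.onFun Disjoint fun x : s => ball (x : X) (ε / 2)) := by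
      intro x y hxy
      refine ball_disjoint_ball ?_
      rw [add_halves]
      exact hs.prop x.2 y.2 (Subtype.coe_injective.ne hxy)
    have h := Measure.countable_meas_pos_of_disjoint_iUnion (μ := μ)
      (fun x : s => measurableSet_ball) hdisj
    have huniv : {i : s | 0 < μ (ball (i : X) (ε / 2))} = univ :=
      eq_univ_of_forall fun i => hμ.ball_pos _ _ (half_pos hε)
    rw [huniv, countable_univ_iff] at h
    exact countable_coe_iff.1 h
  · by_contra! hx
    have hins : (insert x s).Pairwise fun x y => ε ≤ dist x y := by
      refine hs.prop.insert fun y hy _ => ⟨(hx y hy).le, ?_⟩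
      rw [dist_comm]
      exact (hx y hy).le
    have hxs : x ∈ s := hs.le_of_ge hins (subset_insert x s) (mem_insert x s)
    have := hx x hxs
    rw [dist_self] at this
    exact this.not_gt hε

end IsDoublingSpace

theorem inv_measure_ball_mul_le {D : ℝ≥0∞} {r : ℝ} (hr : 0 < r)
    (hD : ∀ (x : X) (r : ℝ), 0 < r → μ (ball x (4 * r)) ≤ D * μ (ball x r))
    {x x' : X} {t : ℝ} (h : t + dist x x' ≤ 4 * r) :
    (μ (ball x' r))⁻¹ * μ (ball x t) ≤ D := by
  rw [← ENNReal.div_eq_inv_mul]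
  exact ENNReal.div_le_of_le_mul ((measure_mono (ball_subset_ball' h)).trans (hD x' r hr))

/-- The integral of `G` over the ball of radius `3 r`, normalized by the measure of the concentric
ball of radius `r`. -/
noncomputable def ballAverage (μ : Measure X) (G : X → ℝ≥0∞) (r : ℝ) (x : X) : ℝ≥0∞ :=
  (μ (ball x r))⁻¹ * ∫⁻ y in ball x (3 * r), G y ∂μ

/-- Hölder's inequality; the factor `D ^ (p - 1)` appears because the integral is over radius `3 r`
but the normalization uses radius `r`. -/
theorem rpow_ballAverage_le (hμ : IsDoublingSpace μ) {D : ℝ≥0∞}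
    (hD : ∀ (x : X) (r : ℝ), 0 < r → μ (ball x (4 * r)) ≤ D * μ (ball x r))
    {p : ℝ} (hp : 1 < p) {G : X → ℝ≥0∞} (hG : Measurable G) {r : ℝ} (hr : 0 < r) (x : X) :
    ballAverage μ G r x ^ p ≤ D ^ (p - 1) * ballAverage μ (fun y => G y ^ p) r x := by
  have hp0 : 0 ≤ p := by linarith
  have hp1 : 0 ≤ p - 1 := by linarith
  have h0 := hμ.measure_ball_ne_zero x hr
  have htop := hμ.measure_ball_ne_top x r
  calc ballAverage μ G r x ^ p
      = (μ (ball x r))⁻¹ ^ p * (∫⁻ y in ball x (3 * r), G y ∂μ) ^ p := by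
        rw [ballAverage, ENNReal.mul_rpow_of_nonneg _ _ hp0]
    _ ≤ (μ (ball x r))⁻¹ ^ p * ((D * μ (ball x r)) ^ (p - 1) *
          ∫⁻ y in ball x (3 * r), G y ^ p ∂μ) := by
        gcongr
        refine (rpow_setLIntegral_le hp hG _).trans ?_
        gcongr
        exact (measure_mono (ball_subset_ball (by linarith))).trans (hD x r hr)
    _ = D ^ (p - 1) * (((μ (ball x r))⁻¹ ^ p * μ (ball x r) ^ (p - 1)) *
          ∫⁻ y in ball x (3 * r), G y ^ p ∂μ) := by
        rw [ENNReal.mul_rpow_of_nonneg _ _ hp1]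
        ring
    _ = D ^ (p - 1) * ballAverage μ (fun y => G y ^ p) r x := by
        rw [ballAverage, ENNReal.inv_rpow, ← ENNReal.rpow_neg, ← ENNReal.rpow_add _ _ h0 htop,
          show -p + (p - 1) = -1 by ring, ENNReal.rpow_neg_one]

section

variable [BorelSpace X]

theorem setLIntegral_ball_eq_lintegral_indicator (G : X → ℝ≥0∞) (r : ℝ) (x : X) :
    ∫⁻ y in ball x r, G y ∂μ =
      ∫⁻ y, {z : X × X | dist z.1 z.2 < r}.indicator (fun z => G z.2) (x, y) ∂μ := by
  rw [← lintegral_indicator measurableSet_ball]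
  refine lintegral_congr fun y => ?_
  simp only [indicator, mem_ball, mem_ofPred_eq, dist_comm]

variable [SecondCountableTopology X] [SFinite μ]

theorem measurableSet_dist_lt (r : ℝ) : MeasurableSet {z : X × X | dist z.1 z.2 < r} :=
  measurableSet_lt (measurable_fst.dist measurable_snd) measurable_const

theorem measurable_setLIntegral_ball {G : X → ℝ≥0∞} (hG : Measurable G) (r : ℝ) :
    Measurable fun x => ∫⁻ y in ball x r, G y ∂μ := by
  simp only [setLIntegral_ball_eq_lintegral_indicator]
  exact Measurable.lintegral_prod_right'
    ((hG.comp measurable_snd).indicator (measurableSet_dist_lt r))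

theorem measurable_measure_ball (r : ℝ) : Measurable fun x : X => μ (ball x r) := by
  simpa using measurable_setLIntegral_ball (μ := μ) (G := fun _ => 1) measurable_const r

theorem measurable_ballAverage {G : X → ℝ≥0∞} (hG : Measurable G) (r : ℝ) :
    Measurable (ballAverage μ G r) :=
  (measurable_measure_ball r).inv.mul (measurable_setLIntegral_ball hG _)

/-- By Tonelli, `H y` gets the weight `∫ μ(B(x, r))⁻¹` over `x ∈ B(y, 3 r)`. Doubling is used once
to compare `B(x, r)` with `B(y, r)` and once for `B(y, 3 r)`, so the bound does not depend on `r`.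
-/
theorem lintegral_ballAverage_le (hμ : IsDoublingSpace μ) {D : ℝ≥0∞}
    (hD : ∀ (x : X) (r : ℝ), 0 < r → μ (ball x (4 * r)) ≤ D * μ (ball x r))
    {H : X → ℝ≥0∞} (hH : Measurable H) {r : ℝ} (hr : 0 < r) :
    ∫⁻ x, ballAverage μ H r x ∂μ ≤ D ^ 2 * ∫⁻ x, H x ∂μ := by
  have hmeas : Measurable fun z : X × X => (μ (ball z.1 r))⁻¹ *
      {z : X × X | dist z.1 z.2 < 3 * r}.indicator (fun z => H z.2) z :=
    ((measurable_measure_ball r).inv.comp measurable_fst).mul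
      ((hH.comp measurable_snd).indicator (measurableSet_dist_lt _))
  have hpt : ∀ y, ∫⁻ x in ball y (3 * r), (μ (ball x r))⁻¹ ∂μ ≤ D ^ 2 := by
    intro y
    have h1 : ∀ x ∈ ball y (3 * r), (μ (ball x r))⁻¹ ≤ D * (μ (ball y r))⁻¹ := by
      intro x hx
      have h2 : μ (ball y r) ≤ D * μ (ball x r) := by
        refine (measure_mono (ball_subset_ball' ?_)).trans (hD x r hr)
        rw [mem_ball, dist_comm] at hx
        linarith
      rw [← ENNReal.div_eq_inv_mul.trans (mul_comm _ _),
        ENNReal.le_div_iff_mul_le (Or.inl (hμ.measure_ball_ne_zero y hr))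
          (Or.inl (hμ.measure_ball_ne_top y r)), mul_comm, ← ENNReal.div_eq_inv_mul.trans
            (mul_comm _ _)]
      exact ENNReal.div_le_of_le_mul h2
    calc ∫⁻ x in ball y (3 * r), (μ (ball x r))⁻¹ ∂μ
        ≤ ∫⁻ _ in ball y (3 * r), D * (μ (ball y r))⁻¹ ∂μ :=
          setLIntegral_mono' measurableSet_ball h1
      _ = D * (μ (ball y r))⁻¹ * μ (ball y (3 * r)) := by
          rw [lintegral_const, Measure.restrict_apply_univ]
      _ ≤ D * (μ (ball y r))⁻¹ * (D * μ (ball y r)) := by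
          gcongr
          exact (measure_mono (ball_subset_ball (by linarith))).trans (hD y r hr)
      _ = D ^ 2 := by
          rw [mul_mul_mul_comm, ENNReal.inv_mul_cancel (hμ.measure_ball_ne_zero y hr)
            (hμ.measure_ball_ne_top y r), mul_one, sq]
  calc ∫⁻ x, ballAverage μ H r x ∂μ
      = ∫⁻ x, ∫⁻ y, (μ (ball x r))⁻¹ *
          {z : X × X | dist z.1 z.2 < 3 * r}.indicator (fun z => H z.2) (x, y) ∂μ ∂μ := by
        refine lintegral_congr fun x => ?_
        rw [ballAverage, setLIntegral_ball_eq_lintegral_indicator,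
          lintegral_const_mul' _ _ (ENNReal.inv_ne_top.2 (hμ.measure_ball_ne_zero x hr))]
    _ = ∫⁻ y, ∫⁻ x, (μ (ball x r))⁻¹ *
          {z : X × X | dist z.1 z.2 < 3 * r}.indicator (fun z => H z.2) (x, y) ∂μ ∂μ :=
        lintegral_lintegral_swap hmeas.aemeasurable
    _ = ∫⁻ y, H y * ∫⁻ x in ball y (3 * r), (μ (ball x r))⁻¹ ∂μ ∂μ := by
        refine lintegral_congr fun y => ?_
        rw [← lintegral_const_mul (H y) (f := fun x => (μ (ball x r))⁻¹)
            (measurable_measure_ball r).inv,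
          ← lintegral_indicator measurableSet_ball]
        refine lintegral_congr fun x => ?_
        simp [indicator, mul_comm]
    _ ≤ ∫⁻ y, D ^ 2 * H y ∂μ := by
        refine lintegral_mono fun y => ?_
        rw [mul_comm]
        gcongr
        exact hpt y
    _ = D ^ 2 * ∫⁻ x, H x ∂μ := lintegral_const_mul _ hH

theorem lintegral_rpow_ballAverage_le (hμ : IsDoublingSpace μ) {D : ℝ≥0∞}
    (hD : ∀ (x : X) (r : ℝ), 0 < r → μ (ball x (4 * r)) ≤ D * μ (ball x r)) (hD' : D ≠ ∞)
    {p : ℝ} (hp : 1 < p) {G : X → ℝ≥0∞} (hG : Measurable G) {r : ℝ} (hr : 0 < r) :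
    ∫⁻ x, ballAverage μ G r x ^ p ∂μ ≤ D ^ (p - 1) * D ^ 2 * ∫⁻ x, G x ^ p ∂μ := by
  calc ∫⁻ x, ballAverage μ G r x ^ p ∂μ
      ≤ ∫⁻ x, D ^ (p - 1) * ballAverage μ (fun y => G y ^ p) r x ∂μ :=
        lintegral_mono fun x => rpow_ballAverage_le hμ hD hp hG hr x
    _ = D ^ (p - 1) * ∫⁻ x, ballAverage μ (fun y => G y ^ p) r x ∂μ :=
        lintegral_const_mul' _ _ (ENNReal.rpow_ne_top_of_nonneg (by linarith) hD')
    _ ≤ D ^ (p - 1) * (D ^ 2 * ∫⁻ x, G x ^ p ∂μ) := by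
        gcongr
        exact lintegral_ballAverage_le hμ hD (hG.pow_const p) hr
    _ = _ := (mul_assoc _ _ _).symm

end

end Doubling

/-! ### Smoothing by tent averages -/

section TentAverage

variable {X : Type*} [MetricSpace X]

/-- The tent of slope one and radius `2 r` centred at `x`. -/
noncomputable def tent (r : ℝ) (x y : X) : ℝ := max 0 (2 * r - dist x y)

theorem tent_nonneg (r : ℝ) (x y : X) : 0 ≤ tent r x y := le_max_left _ _

theorem tent_le {r : ℝ} (hr : 0 < r) (x y : X) : tent r x y ≤ 2 * r :=
  max_le (by linarith) (by linarith [dist_nonneg (x := x) (y := y)])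

theorem tent_eq_zero {r : ℝ} {x y : X} (h : 2 * r ≤ dist x y) : tent r x y = 0 :=
  max_eq_left (by linarith)

theorem le_tent {r : ℝ} {x y : X} (h : dist x y < r) : r ≤ tent r x y :=
  le_max_of_le_right (by linarith)

/-- This Lipschitz dependence on the centre is the reason for tents: averages over balls may be
discontinuous in the centre. -/
theorem abs_tent_sub_tent_le (r : ℝ) (x x' y : X) :
    |tent r x y - tent r x' y| ≤ dist x x' := by
  rw [tent, tent, max_comm 0, max_comm 0]
  refine (abs_max_sub_max_le_abs ..).trans ?_
  rw [show 2 * r - dist x y - (2 * r - dist x' y) = -(dist x y - dist x' y) by ring, abs_neg]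
  exact abs_dist_sub_le x x' y

theorem continuous_tent (r : ℝ) (x : X) : Continuous (tent r x) := by
  unfold tent
  fun_prop

variable [MeasurableSpace X] [BorelSpace X] {μ : Measure X}

/-- The average of `u` with respect to the tent of radius `2 r` centred at `x`. -/
noncomputable def tentAverage (μ : Measure X) (u : X → ℝ) (r : ℝ) (x : X) : ℝ :=
  (∫ y, tent r x y * u y ∂μ) / ∫ y, tent r x y ∂μ

theorem integrable_tent_mul (hμ : IsDoublingSpace μ) {r : ℝ} (hr : 0 < r) (x : X) {u : X → ℝ}
    (hu : AEStronglyMeasurable u μ) {M : ℝ} (hM : ∀ y, |u y| ≤ M) :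
    Integrable (fun y => tent r x y * u y) μ := by
  have hs : Function.support (fun y => tent r x y * u y) ⊆ ball x (2 * r) := by
    intro y hy
    by_contra h
    rw [mem_ball, dist_comm, not_lt] at h
    exact hy (by simp [tent_eq_zero h])
  rw [← integrableOn_iff_integrable_of_support_subset hs]
  refine Measure.integrableOn_of_bounded (M := 2 * r * M) (hμ.measure_ball_ne_top x _)
    ((continuous_tent r x).measurable.aestronglyMeasurable.mul hu) ?_
  refine ae_of_all _ fun y => ?_
  rw [Real.norm_eq_abs, abs_mul, abs_of_nonneg (tent_nonneg r x y)]
  have := tent_le hr x y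
  have := tent_nonneg r x y
  gcongr
  exact hM y

theorem integrable_tent (hμ : IsDoublingSpace μ) {r : ℝ} (hr : 0 < r) (x : X) :
    Integrable (tent r x) μ := by
  simpa using integrable_tent_mul hμ hr x (u := fun _ => 1) aestronglyMeasurable_const
    (M := 1) (by simp)

theorem ofReal_mul_measure_ball_le_integral_tent (hμ : IsDoublingSpace μ) {r : ℝ} (hr : 0 < r)
    (x : X) : ENNReal.ofReal r * μ (ball x r) ≤ ENNReal.ofReal (∫ y, tent r x y ∂μ) := by
  rw [ofReal_integral_eq_lintegral_ofReal (integrable_tent hμ hr x)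
    (ae_of_all _ fun y => tent_nonneg r x y)]
  calc ENNReal.ofReal r * μ (ball x r) = ∫⁻ _ in ball x r, ENNReal.ofReal r ∂μ := by
        rw [lintegral_const, Measure.restrict_apply_univ]
    _ ≤ ∫⁻ y in ball x r, ENNReal.ofReal (tent r x y) ∂μ := by
        refine setLIntegral_mono' measurableSet_ball fun y hy => ?_
        rw [mem_ball, dist_comm] at hy
        exact ENNReal.ofReal_le_ofReal (le_tent hy)
    _ ≤ _ := setLIntegral_le_lintegral _ _

theorem integral_tent_pos (hμ : IsDoublingSpace μ) {r : ℝ} (hr : 0 < r) (x : X) :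
    0 < ∫ y, tent r x y ∂μ := by
  rw [← ENNReal.ofReal_pos]
  refine lt_of_lt_of_le ?_ (ofReal_mul_measure_ball_le_integral_tent hμ hr x)
  exact ENNReal.mul_pos (by simpa using hr) (hμ.measure_ball_ne_zero x hr)

/-- If `k` is bounded by `M`, vanishes off `B(x, R)` and integrates `u - c` to the same value as the
tent at `x`, then `tentAverage μ u r x - c` is controlled by the integral of `|u - c|`. -/
theorem enorm_tentAverage_sub_le_of_kernel (hμ : IsDoublingSpace μ) {r : ℝ} (hr : 0 < r) (x : X)
    {u : X → ℝ} (hu : AEStronglyMeasurable u μ) {M : ℝ} (hM : ∀ y, |u y| ≤ M) (c : ℝ)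
    {k : X → ℝ} {m R : ℝ} (hk : ∀ y, |k y| ≤ m) (hkR : ∀ y, R ≤ dist y x → k y = 0)
    (h : ∫ y, tent r x y * (u y - c) ∂μ = ∫ y, k y * (u y - c) ∂μ) :
    ‖tentAverage μ u r x - c‖ₑ ≤
      ENNReal.ofReal (m / r) * (μ (ball x r))⁻¹ * ∫⁻ y in ball x R, ‖u y - c‖ₑ ∂μ := by
  have hw := integral_tent_pos hμ hr x
  have h1 : (∫ y, tent r x y ∂μ) * (tentAverage μ u r x - c) = ∫ y, k y * (u y - c) ∂μ := by
    rw [← h]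
    simp only [mul_sub]
    rw [integral_sub (integrable_tent_mul hμ hr x hu hM)
      ((integrable_tent hμ hr x).mul_const c), integral_mul_const, tentAverage,
      mul_div_cancel₀ _ hw.ne']
  have h2 : ENNReal.ofReal r * μ (ball x r) * ‖tentAverage μ u r x - c‖ₑ ≤
      ENNReal.ofReal m * ∫⁻ y in ball x R, ‖u y - c‖ₑ ∂μ := by
    calc ENNReal.ofReal r * μ (ball x r) * ‖tentAverage μ u r x - c‖ₑ
        ≤ ‖∫ y, tent r x y ∂μ‖ₑ * ‖tentAverage μ u r x - c‖ₑ := by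
          rw [Real.enorm_of_nonneg hw.le]
          gcongr
          exact ofReal_mul_measure_ball_le_integral_tent hμ hr x
      _ = ‖∫ y, k y * (u y - c) ∂μ‖ₑ := by rw [← enorm_mul, h1]
      _ ≤ ∫⁻ y, ‖k y * (u y - c)‖ₑ ∂μ := enorm_integral_le_lintegral_enorm _
      _ ≤ ∫⁻ y, (ball x R).indicator (fun y => ENNReal.ofReal m * ‖u y - c‖ₑ) y ∂μ := by
          refine lintegral_mono fun y => ?_
          by_cases hy : y ∈ ball x R
          · rw [indicator_of_mem hy, enorm_mul, Real.enorm_eq_ofReal_abs (k y)]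
            gcongr
            exact hk y
          · simp [hkR y (not_lt.1 hy)]
      _ = ENNReal.ofReal m * ∫⁻ y in ball x R, ‖u y - c‖ₑ ∂μ := by
          rw [lintegral_indicator measurableSet_ball,
            lintegral_const_mul' _ _ ENNReal.ofReal_ne_top]
  have h0 : ENNReal.ofReal r * μ (ball x r) ≠ 0 :=
    mul_ne_zero (by simpa using hr) (hμ.measure_ball_ne_zero x hr)
  have htop : ENNReal.ofReal r * μ (ball x r) ≠ ∞ :=
    ENNReal.mul_ne_top ENNReal.ofReal_ne_top (hμ.measure_ball_ne_top x r)
  rw [mul_comm, ← ENNReal.le_div_iff_mul_le (Or.inl h0) (Or.inl htop)] at h2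
  refine h2.trans_eq ?_
  rw [ENNReal.ofReal_div_of_pos hr, ENNReal.div_eq_inv_mul, ENNReal.div_eq_inv_mul,
    ENNReal.mul_inv (Or.inl (by simpa using hr)) (Or.inl ENNReal.ofReal_ne_top)]
  ring

theorem enorm_tentAverage_sub_le (hμ : IsDoublingSpace μ) {r : ℝ} (hr : 0 < r) (x : X)
    {u : X → ℝ} (hu : AEStronglyMeasurable u μ) {M : ℝ} (hM : ∀ y, |u y| ≤ M) (c : ℝ) :
    ‖tentAverage μ u r x - c‖ₑ ≤
      2 * (μ (ball x r))⁻¹ * ∫⁻ y in ball x (2 * r), ‖u y - c‖ₑ ∂μ := by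
  refine (enorm_tentAverage_sub_le_of_kernel hμ hr x hu hM c (k := tent r x) (m := 2 * r)
    (R := 2 * r) (fun y => ?_) (fun y hy => tent_eq_zero (by rwa [dist_comm])) rfl).trans_eq ?_
  · rw [abs_of_nonneg (tent_nonneg r x y)]
    exact tent_le hr x y
  · rw [mul_div_cancel_right₀ _ hr.ne', ENNReal.ofReal_ofNat]

/-- The tent at `x'` integrates `u - tentAverage μ u r x'` to zero, so it may be subtracted from the
tent at `x`. The difference is at most `dist x x'` and vanishes off `B(x, 3 r)`. -/
theorem enorm_tentAverage_sub_tentAverage_le (hμ : IsDoublingSpace μ) {r : ℝ} (hr : 0 < r)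
    {x x' : X} (hx : dist x x' < r)
    {u : X → ℝ} (hu : AEStronglyMeasurable u μ) {M : ℝ} (hM : ∀ y, |u y| ≤ M) :
    ‖tentAverage μ u r x - tentAverage μ u r x'‖ₑ ≤
      ENNReal.ofReal (dist x x' / r) * (μ (ball x r))⁻¹ *
        ∫⁻ y in ball x (3 * r), ‖u y - tentAverage μ u r x'‖ₑ ∂μ := by
  have hint : ∀ z, Integrable (fun y => tent r z y * (u y - tentAverage μ u r x')) μ := by
    intro z
    simp only [mul_sub]
    exact (integrable_tent_mul hμ hr z hu hM).sub ((integrable_tent hμ hr z).mul_const _)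
  refine enorm_tentAverage_sub_le_of_kernel hμ hr x hu hM _
    (k := fun y => tent r x y - tent r x' y) (abs_tent_sub_tent_le r x x') (fun y hy => ?_) ?_
  · have := dist_triangle_right y x x'
    have := dist_triangle_left x y x'
    rw [dist_comm] at hy
    rw [tent_eq_zero (by linarith), tent_eq_zero, sub_zero]
    linarith [dist_triangle x x' y]
  · simp only [sub_mul]
    rw [integral_sub (hint x) (hint x')]
    have h0 : ∫ y, tent r x' y * (u y - tentAverage μ u r x') ∂μ = 0 := by
      simp only [mul_sub]
      rw [integral_sub (integrable_tent_mul hμ hr x' hu hM)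
        ((integrable_tent hμ hr x').mul_const _), integral_mul_const]
      conv_lhs => rw [tentAverage, mul_div_cancel₀ _ (integral_tent_pos hμ hr x').ne']
      exact sub_self _
    rw [h0, sub_zero]

section Gradient

variable {D : ℝ≥0∞} {u : X → ℝ} {M r : ℝ} {G : X → ℝ≥0∞} {E : Set X}

/-- The Hajłasz bound between `y` and `z` is averaged over `z ∈ B(x, 2 r)`; the radii `2 r + 6 r`
stay within its range `8 r`. -/
theorem enorm_tentAverage_sub_self_le (hμ : IsDoublingSpace μ) (hr : 0 < r)
    (hD : ∀ (x : X) (r : ℝ), 0 < r → μ (ball x (4 * r)) ≤ D * μ (ball x r))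
    (hu : AEStronglyMeasurable u μ) (hM : ∀ y, |u y| ≤ M) (hE : μ E = 0)
    (h : ∀ y z, y ∉ E → z ∉ E → dist y z < 8 * r →
      ‖u y - u z‖ₑ ≤ ENNReal.ofReal (8 * r) * (G y + G z))
    {x y : X} (hxy : dist x y < 6 * r) (hy : y ∉ E) :
    ‖tentAverage μ u r x - u y‖ₑ ≤ 2 * ENNReal.ofReal (8 * r) *
      ((μ (ball x r))⁻¹ * ∫⁻ z in ball x (2 * r), G z ∂μ + D * G y) := by
  have hae : ∀ᵐ z ∂μ, z ∉ E := measure_eq_zero_iff_ae_notMem.1 hE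
  have h1 : ∫⁻ z in ball x (2 * r), ‖u z - u y‖ₑ ∂μ ≤
      ENNReal.ofReal (8 * r) * (∫⁻ z in ball x (2 * r), G z ∂μ + G y * μ (ball x (2 * r))) := by
    calc ∫⁻ z in ball x (2 * r), ‖u z - u y‖ₑ ∂μ
        ≤ ∫⁻ z in ball x (2 * r), ENNReal.ofReal (8 * r) * (G z + G y) ∂μ := by
          refine setLIntegral_mono_ae' measurableSet_ball ?_
          filter_upwards [hae] with z hz hzx
          refine h z y hz hy ?_
          rw [mem_ball] at hzx
          linarith [dist_triangle z x y]
      _ = _ := by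
          rw [lintegral_const_mul' _ _ ENNReal.ofReal_ne_top,
            lintegral_add_right _ measurable_const, lintegral_const, Measure.restrict_apply_univ]
  calc ‖tentAverage μ u r x - u y‖ₑ
      ≤ 2 * (μ (ball x r))⁻¹ * ∫⁻ z in ball x (2 * r), ‖u z - u y‖ₑ ∂μ :=
        enorm_tentAverage_sub_le hμ hr x hu hM _
    _ ≤ 2 * (μ (ball x r))⁻¹ * (ENNReal.ofReal (8 * r) *
          (∫⁻ z in ball x (2 * r), G z ∂μ + G y * μ (ball x (2 * r)))) := by gcongr
    _ = 2 * ENNReal.ofReal (8 * r) * ((μ (ball x r))⁻¹ * ∫⁻ z in ball x (2 * r), G z ∂μ +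
          ((μ (ball x r))⁻¹ * μ (ball x (2 * r))) * G y) := by ring
    _ ≤ _ := by
        gcongr
        exact inv_measure_ball_mul_le hr hD (by rw [dist_self]; linarith)

theorem enorm_tentAverage_sub_tentAverage_le_ballAverage (hμ : IsDoublingSpace μ) (hr : 0 < r)
    (hD : ∀ (x : X) (r : ℝ), 0 < r → μ (ball x (4 * r)) ≤ D * μ (ball x r))
    (hu : AEStronglyMeasurable u μ) (hM : ∀ y, |u y| ≤ M) (hG : Measurable G) (hE : μ E = 0)
    (h : ∀ y z, y ∉ E → z ∉ E → dist y z < 8 * r →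
      ‖u y - u z‖ₑ ≤ ENNReal.ofReal (8 * r) * (G y + G z))
    {x x' : X} (hx : dist x x' < r) :
    ‖tentAverage μ u r x - tentAverage μ u r x'‖ₑ ≤
      ENNReal.ofReal (dist x x') * (32 * D * ballAverage μ G r x) := by
  have hae : ∀ᵐ z ∂μ, z ∉ E := measure_eq_zero_iff_ae_notMem.1 hE
  set I := ∫⁻ z in ball x (3 * r), G z ∂μ with hI
  have h1 : ∫⁻ y in ball x (3 * r), ‖u y - tentAverage μ u r x'‖ₑ ∂μ ≤
      2 * ENNReal.ofReal (8 * r) * (2 * D * I) := by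
    -- Here `y` is within `4 r` of `x'`, and `B(x', 2 r) ⊆ B(x, 3 r)`.
    calc ∫⁻ y in ball x (3 * r), ‖u y - tentAverage μ u r x'‖ₑ ∂μ
        ≤ ∫⁻ y in ball x (3 * r), 2 * ENNReal.ofReal (8 * r) *
            ((μ (ball x' r))⁻¹ * I + D * G y) ∂μ := by
          refine setLIntegral_mono_ae' measurableSet_ball ?_
          filter_upwards [hae] with y hy hyx
          rw [mem_ball] at hyx
          rw [enorm_sub_rev]
          refine (enorm_tentAverage_sub_self_le hμ hr hD hu hM hE h ?_ hy).trans ?_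
          · linarith [dist_triangle_left x' y x, dist_comm x y]
          · gcongr
            refine lintegral_mono_set (ball_subset_ball' ?_)
            rw [dist_comm]
            linarith
      _ = 2 * ENNReal.ofReal (8 * r) *
            ((μ (ball x' r))⁻¹ * μ (ball x (3 * r)) * I + D * I) := by
          rw [lintegral_const_mul' _ _ (by finiteness), lintegral_add_left measurable_const,
            lintegral_const, Measure.restrict_apply_univ, lintegral_const_mul _ hG, ← hI]
          ring
      _ ≤ 2 * ENNReal.ofReal (8 * r) * (D * I + D * I) := by
          gcongr
          exact inv_measure_ball_mul_le hr hD (by linarith)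
      _ = _ := by ring
  refine (enorm_tentAverage_sub_tentAverage_le hμ hr hx hu hM).trans ?_
  calc ENNReal.ofReal (dist x x' / r) * (μ (ball x r))⁻¹ *
        ∫⁻ y in ball x (3 * r), ‖u y - tentAverage μ u r x'‖ₑ ∂μ
      ≤ ENNReal.ofReal (dist x x' / r) * (μ (ball x r))⁻¹ *
          (2 * ENNReal.ofReal (8 * r) * (2 * D * I)) := by gcongr
    _ = (ENNReal.ofReal (dist x x' / r) * ENNReal.ofReal (8 * r)) *
          (4 * D * ((μ (ball x r))⁻¹ * I)) := by ring
    -- The scale cancels, `(d / r) * 8 r = 8 d`, which gives `8 * 4 D = 32 D`.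
    _ = ENNReal.ofReal (dist x x') * (32 * D * ballAverage μ G r x) := by
        rw [← ENNReal.ofReal_mul (by positivity),
          show dist x x' / r * (8 * r) = dist x x' * 8 by field_simp,
          ENNReal.ofReal_mul dist_nonneg, ballAverage, ENNReal.ofReal_ofNat, hI]
        ring

end Gradient

end TentAverage

/-! ### From the Poincaré inequality to constancy -/

section Poincare

open Filter Topology

/-- The constants `c` vary with `ε`, but the mean of `u` is at most twice as bad as any of them, so
it serves for all `ε`. -/
theorem ae_eq_const_of_forall_exists_lintegral_sub_le {α : Type*} [MeasurableSpace α]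
    {ν : Measure α} [IsFiniteMeasure ν] {u : α → ℝ} (hu : Integrable u ν)
    (h : ∀ ε : ℝ≥0∞, ε ≠ 0 → ∃ c : ℝ, ∫⁻ x, ‖u x - c‖ₑ ∂ν ≤ ε) :
    ∃ c : ℝ, ∀ᵐ x ∂ν, u x = c := by
  rcases eq_zero_or_neZero ν with rfl | hν
  · exact ⟨0, by simp⟩
  refine ⟨⨍ x, u x ∂ν, ?_⟩
  set a := ⨍ x, u x ∂ν with ha
  have hpos : 0 < ν.real univ := measureReal_univ_pos
  have key : ∀ c : ℝ, ∫⁻ x, ‖u x - a‖ₑ ∂ν ≤ 2 * ∫⁻ x, ‖u x - c‖ₑ ∂ν := by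
    intro c
    have h1 : ν.real univ * (c - a) = -∫ x, (u x - c) ∂ν := by
      rw [integral_sub hu (integrable_const c), integral_const, ha, average_eq, smul_eq_mul,
        smul_eq_mul]
      field_simp
      ring
    have h2 : ‖c - a‖ₑ * ν univ ≤ ∫⁻ x, ‖u x - c‖ₑ ∂ν := by
      calc ‖c - a‖ₑ * ν univ = ‖ν.real univ * (c - a)‖ₑ := by
            rw [enorm_mul, Real.enorm_of_nonneg hpos.le, ofReal_measureReal, mul_comm]
        _ = ‖∫ x, (u x - c) ∂ν‖ₑ := by rw [h1, enorm_neg]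
        _ ≤ _ := enorm_integral_le_lintegral_enorm _
    calc ∫⁻ x, ‖u x - a‖ₑ ∂ν ≤ ∫⁻ x, (‖u x - c‖ₑ + ‖c - a‖ₑ) ∂ν := by
          refine lintegral_mono fun x => ?_
          rw [← sub_add_sub_cancel (u x) c a]
          exact enorm_add_le _ _
      _ = ∫⁻ x, ‖u x - c‖ₑ ∂ν + ‖c - a‖ₑ * ν univ := by
          rw [lintegral_add_right _ measurable_const, lintegral_const]
      _ ≤ _ := by
          rw [two_mul]
          gcongr
  have h0 : ∫⁻ x, ‖u x - a‖ₑ ∂ν = 0 := by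
    refine le_antisymm (ENNReal.le_of_forall_pos_le_add fun ε hε _ => ?_) zero_le
    obtain ⟨c, hc⟩ := h (ε / 2) (by simpa using hε.ne')
    rw [zero_add]
    calc ∫⁻ x, ‖u x - a‖ₑ ∂ν ≤ 2 * (ε / 2) := (key c).trans (by gcongr)
      _ = ε := ENNReal.mul_div_cancel (by simp) (by simp)
  have hmeas : AEMeasurable (fun x => ‖u x - a‖ₑ) ν :=
    (hu.sub (integrable_const a)).aestronglyMeasurable.enorm
  rw [lintegral_eq_zero_iff' hmeas] at h0
  filter_upwards [h0] with x hx
  simpa [sub_eq_zero] using hx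

theorem setLIntegral_le_of_one_lt {α : Type*} [MeasurableSpace α] {μ : Measure α} {p : ℝ}
    (hp : 1 < p) {G : α → ℝ≥0∞} (hG : Measurable G) (S : Set α) :
    ∫⁻ y in S, G y ∂μ ≤ (μ S ^ (p - 1)) ^ p⁻¹ * (∫⁻ y, G y ^ p ∂μ) ^ p⁻¹ := by
  have hp0 : 0 < p := by linarith
  rw [← ENNReal.mul_rpow_of_nonneg _ _ (inv_nonneg.2 hp0.le), ENNReal.le_rpow_inv_iff hp0]
  exact (rpow_setLIntegral_le hp hG S).trans (mul_le_mul' le_rfl (setLIntegral_le_lintegral _ _))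

variable {X : Type*} [MetricSpace X] [MeasurableSpace X] [BorelSpace X] {μ : Measure X}

/-- On a fixed ball, the mean oscillation of a bounded function is controlled by the `L^p` norm of
any function which acts as a Hajlasz gradient at small distances. -/
theorem SupportsWeakPoincare.exists_setLIntegral_sub_le (hμ : IsDoublingSpace μ) {p : ℝ}
    (hp : 1 < p) (hP : SupportsWeakPoincare μ p) (x₀ : X) {R : ℝ} (hR : 0 < R) :
    ∃ K : ℝ≥0∞, K ≠ ∞ ∧ ∀ (u : X → ℝ) (M r : ℝ) (G : X → ℝ≥0∞) (E : Set X),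
      AEStronglyMeasurable u μ → (∀ y, |u y| ≤ M) → 0 < r → r ≤ 1 → Measurable G →
      ∫⁻ y, G y ^ p ∂μ ≠ ∞ → μ E = 0 →
      (∀ y z, y ∉ E → z ∉ E → dist y z < 8 * r →
        ‖u y - u z‖ₑ ≤ ENNReal.ofReal (8 * r) * (G y + G z)) →
      ∃ c : ℝ, ∫⁻ y in ball x₀ R, ‖u y - c‖ₑ ∂μ ≤ K * (∫⁻ y, G y ^ p ∂μ) ^ p⁻¹ := by
  have hp0 : 0 < p := by linarith
  have hp1 : 0 ≤ p - 1 := by linarith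
  have hpi : 0 ≤ p⁻¹ := inv_nonneg.2 hp0.le
  have := hμ.sigmaFinite
  have := hμ.secondCountableTopology
  obtain ⟨D, hDtop, hD⟩ := hμ.exists_measure_ball_four_mul_le
  obtain ⟨C, t, hC, ht, hPoin⟩ := hP
  have htR : 0 < t * R := by positivity
  have hm0 := hμ.measure_ball_ne_zero x₀ hR
  have hmtop := hμ.measure_ball_ne_top x₀ R
  set L : ℝ≥0∞ := (μ (ball x₀ R) ^ (p - 1)) ^ p⁻¹ with hL
  set Q : ℝ≥0∞ := D ^ (p - 1) * D ^ 2 with hQ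
  set T : ℝ≥0∞ := (32 * D) ^ p * Q / μ (ball x₀ (t * R)) with hT
  have hLtop : L ≠ ∞ := by
    refine ENNReal.rpow_ne_top_of_nonneg hpi (ENNReal.rpow_ne_top_of_nonneg hp1 hmtop)
  have hQtop : Q ≠ ∞ := ENNReal.mul_ne_top (ENNReal.rpow_ne_top_of_nonneg hp1 hDtop)
    (ENNReal.pow_ne_top hDtop)
  have hTtop : T ≠ ∞ := by
    refine ENNReal.div_ne_top (ENNReal.mul_ne_top (ENNReal.rpow_ne_top_of_nonneg hp0.le ?_) hQtop)
      (hμ.measure_ball_ne_zero x₀ htR)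
    exact ENNReal.mul_ne_top (by simp) hDtop
  -- The first term will bound `u - v`, the second the oscillation of `v`. Neither involves `u`, `G`
  -- or `r`.
  refine ⟨16 * (L * Q ^ p⁻¹ + D * L) + ENNReal.ofReal (C * R) * T ^ p⁻¹ * μ (ball x₀ R), ?_, ?_⟩
  · have h1 := ENNReal.rpow_ne_top_of_nonneg hpi hQtop
    have h2 := ENNReal.rpow_ne_top_of_nonneg hpi hTtop
    finiteness
  intro u M r G E hu hM hr hr1 hG hGtop hE h
  set N : ℝ≥0∞ := (∫⁻ y, G y ^ p ∂μ) ^ p⁻¹ with hN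
  set v := tentAverage μ u r with hv
  set A := ballAverage μ G r with hA
  have hAm : Measurable A := measurable_ballAverage hG r
  have hAp : ∫⁻ x, A x ^ p ∂μ ≤ Q * ∫⁻ x, G x ^ p ∂μ :=
    lintegral_rpow_ballAverage_le hμ hD hDtop hp hG hr
  have hAtop : ∀ x, A x ≠ ∞ := by
    intro x
    refine ENNReal.mul_ne_top (ENNReal.inv_ne_top.2 (hμ.measure_ball_ne_zero x hr)) ?_
    refine ne_top_of_le_ne_top ?_ (setLIntegral_le_of_one_lt hp hG _)
    exact ENNReal.mul_ne_top (ENNReal.rpow_ne_top_of_nonneg hpi (ENNReal.rpow_ne_top_of_nonneg hp1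
      (hμ.measure_ball_ne_top x _))) (ENNReal.rpow_ne_top_of_nonneg hpi hGtop)
  have hlip : ∀ x y, dist x y < r →
      ‖v x - v y‖ₑ ≤ ENNReal.ofReal (dist x y) * (32 * D * A x) := fun x y hxy =>
    enorm_tentAverage_sub_tentAverage_le_ballAverage hμ hr hD hu hM hG hE h hxy
  have hρtop : ∀ x, 32 * D * A x ≠ ∞ := fun x =>
    ENNReal.mul_ne_top (ENNReal.mul_ne_top (by simp) hDtop) (hAtop x)
  -- Since `A x` is finite at every point, `v` has a finite Lipschitz constant at each centre `x`.
  have hvc : Continuous v := by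
    refine continuous_iff_continuousAt.2 fun x => ?_
    refine continuousAt_of_locally_lipschitz hr (32 * D * A x).toReal fun y hy => ?_
    rw [dist_comm] at hy
    have h1 := ENNReal.toReal_mono (ENNReal.mul_ne_top ENNReal.ofReal_ne_top (hρtop x))
      (hlip x y hy)
    rw [toReal_enorm, ENNReal.toReal_mul, ENNReal.toReal_ofReal dist_nonneg] at h1
    rwa [dist_comm, dist_eq_norm, dist_comm, mul_comm]
  have hvb : ∀ x, ‖v x‖ ≤ (2 * (D * ENNReal.ofReal M)).toReal := by
    intro x
    rw [← toReal_enorm]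
    refine ENNReal.toReal_mono (by finiteness) ?_
    have h1 := enorm_tentAverage_sub_le hμ hr x hu hM 0
    simp only [sub_zero] at h1
    refine h1.trans ?_
    calc 2 * (μ (ball x r))⁻¹ * ∫⁻ y in ball x (2 * r), ‖u y‖ₑ ∂μ
        ≤ 2 * (μ (ball x r))⁻¹ * ∫⁻ _ in ball x (2 * r), ENNReal.ofReal M ∂μ := by
          gcongr with y
          rw [Real.enorm_eq_ofReal_abs]
          exact ENNReal.ofReal_le_ofReal (hM y)
      _ = 2 * ((μ (ball x r))⁻¹ * μ (ball x (2 * r)) * ENNReal.ofReal M) := by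
          rw [lintegral_const, Measure.restrict_apply_univ]
          ring
      _ ≤ _ := by
          gcongr
          exact inv_measure_ball_mul_le hr hD (by rw [dist_self]; linarith)
  have hvint : ∀ (y : X) (R : ℝ), IntegrableOn v (ball y R) μ := fun y R =>
    Measure.integrableOn_of_bounded (hμ.measure_ball_ne_top y R)
      hvc.measurable.aestronglyMeasurable (ae_of_all _ hvb)
  have hgrad : IsWeakUpperGradient μ p v fun x => 32 * D * A x := by
    refine isWeakUpperGradient_of_dist_lt μ hp0 hr (hAm.const_mul _) hvc fun x y hxy => ?_
    rw [← Real.enorm_eq_ofReal_abs]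
    exact hlip x y hxy
  refine ⟨⨍ w in ball x₀ R, v w ∂μ, ?_⟩
  set c := ⨍ w in ball x₀ R, v w ∂μ with hc
  have hosc : ∫⁻ y in ball x₀ R, ‖v y - c‖ₑ ∂μ ≤
      ENNReal.ofReal (C * R) * T ^ p⁻¹ * μ (ball x₀ R) * N := by
    have h1 := hPoin v _ hvint hgrad x₀ R hR
    rw [setLAverage_eq, ENNReal.div_le_iff hm0 hmtop] at h1
    simp only [← Real.enorm_eq_ofReal_abs] at h1
    refine h1.trans ?_
    rw [mul_right_comm _ _ N, mul_assoc _ (T ^ p⁻¹) N, ← ENNReal.mul_rpow_of_nonneg _ _ hpi,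
      one_div]
    gcongr
    rw [setLAverage_eq, hT, ENNReal.div_eq_inv_mul, ENNReal.div_eq_inv_mul, mul_assoc]
    gcongr
    calc ∫⁻ x in ball x₀ (t * R), (32 * D * A x) ^ p ∂μ ≤ ∫⁻ x, (32 * D * A x) ^ p ∂μ :=
          setLIntegral_le_lintegral _ _
      _ = (32 * D) ^ p * ∫⁻ x, A x ^ p ∂μ := by
          rw [← lintegral_const_mul _ (hAm.pow_const p)]
          exact lintegral_congr fun x => ENNReal.mul_rpow_of_nonneg _ _ hp0.le
      _ ≤ (32 * D) ^ p * (Q * ∫⁻ x, G x ^ p ∂μ) := by gcongr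
      _ = _ := (mul_assoc _ _ _).symm
  have hdiff : ∫⁻ y in ball x₀ R, ‖u y - v y‖ₑ ∂μ ≤ 16 * (L * Q ^ p⁻¹ + D * L) * N := by
    have hae : ∀ᵐ y ∂μ, y ∉ E := measure_eq_zero_iff_ae_notMem.1 hE
    calc ∫⁻ y in ball x₀ R, ‖u y - v y‖ₑ ∂μ
        ≤ ∫⁻ y in ball x₀ R, 16 * (A y + D * G y) ∂μ := by
          refine lintegral_mono_ae (ae_restrict_of_ae ?_)
          filter_upwards [hae] with y hy
          rw [enorm_sub_rev]
          refine (enorm_tentAverage_sub_self_le hμ hr hD hu hM hE h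
            (by rw [dist_self]; linarith) hy).trans ?_
          -- The bound `r ≤ 1` removes the scale from the constant.
          have h8 : 2 * ENNReal.ofReal (8 * r) ≤ 16 := by
            calc 2 * ENNReal.ofReal (8 * r) ≤ 2 * ENNReal.ofReal 8 := by
                  gcongr
                  linarith
              _ = 16 := by
                  rw [ENNReal.ofReal_ofNat]
                  norm_num
          refine mul_le_mul' h8 (add_le_add (mul_le_mul' le_rfl ?_) le_rfl)
          exact lintegral_mono_set (ball_subset_ball (by linarith))
      _ = 16 * (∫⁻ y in ball x₀ R, A y ∂μ + D * ∫⁻ y in ball x₀ R, G y ∂μ) := by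
          rw [lintegral_const_mul' _ _ (by simp), lintegral_add_left hAm,
            lintegral_const_mul _ hG]
      _ ≤ 16 * (L * (Q ^ p⁻¹ * N) + D * (L * N)) := by
          gcongr
          · refine (setLIntegral_le_of_one_lt hp hAm _).trans (mul_le_mul' le_rfl ?_)
            rw [hN, ← ENNReal.mul_rpow_of_nonneg _ _ hpi]
            gcongr
          · exact setLIntegral_le_of_one_lt hp hG _
      _ = _ := by ring
  calc ∫⁻ y in ball x₀ R, ‖u y - c‖ₑ ∂μ
      ≤ ∫⁻ y in ball x₀ R, (‖u y - v y‖ₑ + ‖v y - c‖ₑ) ∂μ := by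
        refine lintegral_mono fun y => ?_
        rw [← sub_add_sub_cancel (u y) (v y) c]
        exact enorm_add_le _ _
    _ = ∫⁻ y in ball x₀ R, ‖u y - v y‖ₑ ∂μ + ∫⁻ y in ball x₀ R, ‖v y - c‖ₑ ∂μ :=
        lintegral_add_right _ (hvc.measurable.sub_const c).enorm
    _ ≤ _ := by
        rw [add_mul]
        gcongr

theorem SupportsWeakPoincare.ae_eq_const_of_bounded (hμ : IsDoublingSpace μ) {p : ℝ}
    (hp : 1 < p) (hP : SupportsWeakPoincare μ p) {u : X → ℝ} {M : ℝ}
    (hu : AEStronglyMeasurable u μ) (hM : ∀ y, |u y| ≤ M)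
    (h : ∀ ε : ℝ≥0∞, ε ≠ 0 → ∃ (r : ℝ) (G : X → ℝ≥0∞) (E : Set X), 0 < r ∧ r ≤ 1 ∧ Measurable G ∧
      ∫⁻ y, G y ^ p ∂μ ≤ ε ∧ μ E = 0 ∧
      ∀ y z, y ∉ E → z ∉ E → dist y z < 8 * r →
        ‖u y - u z‖ₑ ≤ ENNReal.ofReal (8 * r) * (G y + G z)) :
    ∃ c : ℝ, u =ᵐ[μ] fun _ => c := by
  have hp0 : 0 < p := by linarith
  rcases isEmpty_or_nonempty X with hX | ⟨⟨x₀⟩⟩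
  · exact ⟨0, ae_of_all _ fun x => hX.elim x⟩
  have hball : ∀ n : ℕ, ∃ c : ℝ, ∀ᵐ x ∂μ, x ∈ ball x₀ (n + 1) → u x = c := by
    intro n
    have hn : (0 : ℝ) < n + 1 := by positivity
    obtain ⟨K, hK, hKu⟩ := hP.exists_setLIntegral_sub_le hμ hp x₀ hn
    have hfin : IsFiniteMeasure (μ.restrict (ball x₀ (n + 1))) :=
      isFiniteMeasure_restrict.2 (hμ.measure_ball_ne_top _ _)
    have hint : IntegrableOn u (ball x₀ (n + 1)) μ :=
      Measure.integrableOn_of_bounded (hμ.measure_ball_ne_top _ _) hu (ae_of_all _ hM)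
    obtain ⟨c, hc⟩ := ae_eq_const_of_forall_exists_lintegral_sub_le hint fun ε hε => by
      -- `K + 1` avoids division by zero, and `min ε 1` covers `ε = ∞`.
      have hK1 : K + 1 ≠ ∞ := by finiteness
      have hε' : min ε 1 / (K + 1) ≠ 0 := ENNReal.div_ne_zero.2 ⟨by simp [hε], hK1⟩
      have hε'' : min ε 1 / (K + 1) ≠ ∞ := ENNReal.div_ne_top (by simp) (by simp)
      obtain ⟨r, G, E, hr, hr1, hG, hGε, hE, hGE⟩ := h ((min ε 1 / (K + 1)) ^ p)
        (by simp [ENNReal.rpow_eq_zero_iff, hε', hp0.le])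
      obtain ⟨c, hc⟩ := hKu u M r G E hu hM hr hr1 hG
        (ne_top_of_le_ne_top (ENNReal.rpow_ne_top_of_nonneg hp0.le hε'') hGε) hE hGE
      refine ⟨c, hc.trans ?_⟩
      calc K * (∫⁻ y, G y ^ p ∂μ) ^ p⁻¹ ≤ (K + 1) * (min ε 1 / (K + 1)) := by
            gcongr
            · exact le_self_add
            · rwa [ENNReal.rpow_inv_le_iff hp0]
        _ = min ε 1 := ENNReal.mul_div_cancel (by simp) hK1
        _ ≤ ε := min_le_left _ _
    exact ⟨c, (ae_restrict_iff' measurableSet_ball).1 hc⟩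
  choose c hc using hball
  have hall : ∀ᵐ x ∂μ, ∀ n : ℕ, x ∈ ball x₀ (n + 1) → u x = c n := ae_all_iff.2 hc
  -- A single good point in the unit ball lies in all the balls and so identifies their constants.
  obtain ⟨x₁, hx₁, hx₁c⟩ : ∃ x ∈ ball x₀ 1, ∀ n : ℕ, x ∈ ball x₀ (n + 1) → u x = c n := by
    by_contra! hcon
    refine hμ.measure_ball_ne_zero x₀ one_pos (measure_mono_null (fun x hx => ?_) hall)
    obtain ⟨n, hn, hne⟩ := hcon x hx
    exact fun hx' => hne (hx' n hn)
  refine ⟨u x₁, ?_⟩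
  filter_upwards [hall] with x hx
  obtain ⟨n, hn⟩ := exists_nat_gt (dist x x₀)
  have h1 : x₁ ∈ ball x₀ ((n : ℝ) + 1) := ball_subset_ball (by simp) hx₁
  rw [hx n (by rw [mem_ball]; linarith), hx₁c n h1]

end Poincare

/-! ### Decay of the gradients at small scales -/

section SequenceNorms

open Filter Topology

/-- The `ℓ^p` combination of the `g_m`, `m ≥ k`, with weights `2 ^ (k - m)`. -/
noncomputable def weightedTail {X : Type*} (p : ℝ) (g : ℤ → X → ℝ≥0) (k : ℤ) (x : X) : ℝ≥0∞ :=
  (∑' j : ℕ, ((2⁻¹ : ℝ≥0∞) ^ j * g (k + j) x) ^ p) ^ p⁻¹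

theorem le_weightedTail {X : Type*} {p : ℝ} (hp : 0 < p) (g : ℤ → X → ℝ≥0) (k : ℤ) (j : ℕ) (x : X) :
    (2⁻¹ : ℝ≥0∞) ^ j * g (k + j) x ≤ weightedTail p g k x := by
  rw [weightedTail, ENNReal.le_rpow_inv_iff hp]
  exact ENNReal.le_tsum (f := fun j : ℕ => ((2⁻¹ : ℝ≥0∞) ^ j * g (k + j) x) ^ p) j

variable {X : Type*} [MeasurableSpace X] {μ : Measure X}

theorem measurable_weightedTail {p : ℝ} {g : ℤ → X → ℝ≥0} (hg : ∀ k, Measurable (g k)) (k : ℤ) :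
    Measurable (weightedTail p g k) :=
  (Measurable.tsum fun _ =>
    (((hg _).coe_nnreal_ennreal.const_mul _).pow_const p)).pow_const _

/-- The `ℓ^p` combination lets sum and integral be exchanged whatever `q` is. Since `p > 1`, the
weights satisfy `(2^(-j))^p ≤ 2^(-j)`, and the geometric series sums to `2`. -/
theorem lintegral_weightedTail_rpow_le {p : ℝ} (hp : 1 < p) {g : ℤ → X → ℝ≥0}
    (hg : ∀ k, Measurable (g k)) {k : ℤ} {ε : ℝ≥0∞}
    (h : ∀ m, k ≤ m → ∫⁻ x, (g m x : ℝ≥0∞) ^ p ∂μ ≤ ε) :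
    ∫⁻ x, weightedTail p g k x ^ p ∂μ ≤ 2 * ε := by
  have hp0 : 0 < p := by linarith
  calc ∫⁻ x, weightedTail p g k x ^ p ∂μ
      = ∫⁻ x, ∑' j : ℕ, ((2⁻¹ : ℝ≥0∞) ^ j * g (k + j) x) ^ p ∂μ := by
        refine lintegral_congr fun x => ?_
        rw [weightedTail, ENNReal.rpow_inv_rpow hp0.ne']
    _ = ∑' j : ℕ, ∫⁻ x, ((2⁻¹ : ℝ≥0∞) ^ j * g (k + j) x) ^ p ∂μ :=
        lintegral_tsum fun _ =>
          (((hg _).coe_nnreal_ennreal.const_mul _).pow_const p).aemeasurable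
    _ ≤ ∑' j : ℕ, (2⁻¹ : ℝ≥0∞) ^ j * ε := by
        refine ENNReal.tsum_le_tsum fun j => ?_
        calc ∫⁻ x, ((2⁻¹ : ℝ≥0∞) ^ j * g (k + j) x) ^ p ∂μ
            ≤ ∫⁻ x, (2⁻¹ : ℝ≥0∞) ^ j * (g (k + j) x : ℝ≥0∞) ^ p ∂μ := by
              refine lintegral_mono fun x => ?_
              rw [ENNReal.mul_rpow_of_nonneg _ _ hp0.le]
              gcongr
              exact ENNReal.rpow_le_self_of_le_one (pow_le_one' (by simp) j) hp.le
          _ = (2⁻¹ : ℝ≥0∞) ^ j * ∫⁻ x, (g (k + j) x : ℝ≥0∞) ^ p ∂μ :=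
              lintegral_const_mul' _ _ (by finiteness)
          _ ≤ (2⁻¹ : ℝ≥0∞) ^ j * ε := by
              gcongr
              exact h _ (by simp)
    _ = 2 * ε := by
        rw [ENNReal.tsum_mul_right, ENNReal.tsum_geometric, ENNReal.one_sub_inv_two, inv_inv]

/-- The terms of a convergent series tend to zero; the power `p / q` recovers the integrals from
them. -/
theorem tendsto_lintegral_rpow_of_lqLpNorm_lt_top {p q : ℝ} (hp : 0 < p) (hq : 0 < q)
    {g : ℤ → X → ℝ≥0} (h : lqLpNorm μ p q g < ∞) :
    Tendsto (fun k => ∫⁻ x, (g k x : ℝ≥0∞) ^ p ∂μ) atTop (𝓝 0) := by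
  have h1 : ∑' k : ℤ, ((∫⁻ x, (g k x : ℝ≥0∞) ^ p ∂μ) ^ (1 / p)) ^ q ≠ ∞ := by
    intro htop
    rw [lqLpNorm, htop, ENNReal.top_rpow_of_pos (by positivity)] at h
    exact lt_irrefl _ h
  have h2 := (ENNReal.tendsto_cofinite_zero_of_tsum_ne_top h1).mono_left atTop_le_cofinite
  have h3 := h2.ennrpow_const (p / q)
  rw [ENNReal.zero_rpow_of_pos (by positivity)] at h3
  refine h3.congr fun k => ?_
  rw [← ENNReal.rpow_mul, ← ENNReal.rpow_mul, show 1 / p * (q * (p / q)) = 1 by field_simp,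
    ENNReal.rpow_one]

/-- Dominated convergence: `g_k ^ p` is at most the `p`-th power `F` of the `ℓ^q` norm, which is
integrable, and `g_k → 0` wherever that norm is finite. -/
theorem tendsto_lintegral_rpow_of_lpLqNorm_lt_top {p q : ℝ} (hp : 0 < p) (hq : 0 < q)
    {g : ℤ → X → ℝ≥0} (hg : ∀ k, AEMeasurable (g k) μ) (h : lpLqNorm μ p q g < ∞) :
    Tendsto (fun k => ∫⁻ x, (g k x : ℝ≥0∞) ^ p ∂μ) atTop (𝓝 0) := by
  set F : X → ℝ≥0∞ := fun x => ((∑' k : ℤ, (g k x : ℝ≥0∞) ^ q) ^ (1 / q)) ^ p with hF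
  have hFm : AEMeasurable F μ :=
    ((AEMeasurable.tsum fun k => ((hg k).coe_nnreal_ennreal.pow_const q)).pow_const _).pow_const p
  have hFtop : ∫⁻ x, F x ∂μ ≠ ∞ := by
    intro htop
    rw [lpLqNorm, ← hF, htop, ENNReal.top_rpow_of_pos (by positivity)] at h
    exact lt_irrefl _ h
  have hsum : ∀ᵐ x ∂μ, ∑' k : ℤ, (g k x : ℝ≥0∞) ^ q ≠ ∞ := by
    filter_upwards [ae_lt_top' hFm hFtop] with x hx htop
    simp only [hF] at hx
    rw [htop, ENNReal.top_rpow_of_pos (by positivity), ENNReal.top_rpow_of_pos hp] at hx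
    exact lt_irrefl _ hx
  have hpow : ∀ (k : ℤ) (x : X),
      (g k x : ℝ≥0∞) ^ p = (((g k x : ℝ≥0∞) ^ q) ^ (1 / q)) ^ p := by
    intro k x
    rw [← ENNReal.rpow_mul _ q, mul_one_div_cancel hq.ne', ENNReal.rpow_one]
  have := tendsto_lintegral_filter_of_dominated_convergence' (μ := μ) (l := (atTop : Filter ℤ))
    (F := fun k x => (g k x : ℝ≥0∞) ^ p) (f := fun _ => 0) F
    (Eventually.of_forall fun k => (hg k).coe_nnreal_ennreal.pow_const p)
    (Eventually.of_forall fun k => ae_of_all _ fun x => ?_) hFtop ?_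
  · simpa using this
  · rw [hpow]
    simp only [hF]
    gcongr
    exact ENNReal.le_tsum (f := fun k : ℤ => (g k x : ℝ≥0∞) ^ q) k
  · filter_upwards [hsum] with x hx
    have h2 := (ENNReal.tendsto_cofinite_zero_of_tsum_ne_top hx).mono_left
      (atTop_le_cofinite (α := ℤ))
    have h3 := (h2.ennrpow_const (1 / q)).ennrpow_const p
    rw [ENNReal.zero_rpow_of_pos (by positivity), ENNReal.zero_rpow_of_pos hp] at h3
    exact h3.congr fun k => (hpow k x).symm

end SequenceNorms

/-! ### Hajłasz gradients and the conclusion -/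

section Hajlasz

open Filter Topology

theorem Real.abs_arctan_sub_arctan_le (a b : ℝ) : |Real.arctan a - Real.arctan b| ≤ |a - b| := by
  have h : LipschitzWith 1 Real.arctan :=
    lipschitzWith_of_nnnorm_deriv_le Real.differentiable_arctan fun x => by
      rw [Real.deriv_arctan, ← NNReal.coe_le_coe, coe_nnnorm, Real.norm_eq_abs,
        abs_of_nonneg (by positivity), NNReal.coe_one, div_le_one (by positivity)]
      nlinarith [sq_nonneg x]
  simpa [Real.dist_eq] using h.dist_le_mul a b

/-- The pair lies in one dyadic annulus, of index `k + j` with `j ≥ 0`. There `d(x, y) ≤ 2^(-k)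
2^(-j)`, and `2^(-j)` is the weight of `g (k + j)` in the tail. -/
theorem enorm_sub_le_weightedTail {X : Type*} [MetricSpace X] {p : ℝ} (hp : 0 < p) {u : X → ℝ} {g : ℤ → X → ℝ≥0}
    {E : Set X} (h : ∀ (k : ℤ) (x y : X), x ∉ E → y ∉ E → (2 : ℝ) ^ (-k - 1) ≤ dist x y →
      dist x y < (2 : ℝ) ^ (-k) → |u x - u y| ≤ dist x y * ((g k x : ℝ) + (g k y : ℝ)))
    (k : ℤ) {x y : X} (hx : x ∉ E) (hy : y ∉ E) (hxy : dist x y < (2 : ℝ) ^ (-k)) :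
    ‖u x - u y‖ₑ ≤
      ENNReal.ofReal ((2 : ℝ) ^ (-k)) * (weightedTail p g k x + weightedTail p g k y) := by
  rcases eq_or_ne x y with rfl | hne
  · simp
  obtain ⟨n, hn1, hn2⟩ := exists_mem_Ico_zpow (dist_pos.2 hne) (one_lt_two (α := ℝ))
  have hnk : n < -k := (zpow_lt_zpow_iff_right₀ one_lt_two).1 (hn1.trans_lt hxy)
  obtain ⟨j, hj⟩ : ∃ j : ℕ, -n - 1 = k + j := ⟨(-n - 1 - k).toNat, by omega⟩
  have h1 := h (k + j) x y hx hy (by rwa [← hj, show -(-n - 1) - 1 = n by ring])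
    (by rwa [← hj, show -(-n - 1) = n + 1 by ring])
  have h2 : dist x y ≤ (2 : ℝ) ^ (-k) * (2⁻¹) ^ j := by
    refine hn2.le.trans_eq ?_
    rw [show n + 1 = -k - j by omega, zpow_sub₀ two_ne_zero, zpow_natCast, inv_pow,
      div_eq_mul_inv]
  calc ‖u x - u y‖ₑ = ENNReal.ofReal |u x - u y| := Real.enorm_eq_ofReal_abs _
    _ ≤ ENNReal.ofReal ((2 : ℝ) ^ (-k) * (2⁻¹) ^ j *
          ((g (k + j) x : ℝ) + (g (k + j) y : ℝ))) := by
        refine ENNReal.ofReal_le_ofReal (h1.trans ?_)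
        gcongr
    _ = ENNReal.ofReal ((2 : ℝ) ^ (-k)) *
          ((2⁻¹ : ℝ≥0∞) ^ j * g (k + j) x + (2⁻¹ : ℝ≥0∞) ^ j * g (k + j) y) := by
        rw [ENNReal.ofReal_mul (by positivity), ENNReal.ofReal_mul (by positivity),
          ENNReal.ofReal_add (by positivity) (by positivity), ENNReal.ofReal_coe_nnreal,
          ENNReal.ofReal_coe_nnreal, ENNReal.ofReal_pow (by positivity),
          ENNReal.ofReal_inv_of_pos two_pos, ENNReal.ofReal_ofNat, mul_assoc, mul_add]
    _ ≤ _ := by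
        gcongr
        · exact le_weightedTail hp g k j x
        · exact le_weightedTail hp g k j y

variable {X : Type*} [MetricSpace X] [MeasurableSpace X] {μ : Measure X}

/-- There are only countably many indices, so the points where some representative differs can be
added to the null set. -/
theorem IsFracHajlaszGradient.exists_measurable {s : ℝ} {u : X → ℝ} {g : ℤ → X → ℝ≥0}
    (hg : IsFracHajlaszGradient μ s u g) :
    ∃ g' : ℤ → X → ℝ≥0, IsFracHajlaszGradient μ s u g' ∧ (∀ k, Measurable (g' k)) ∧
      ∀ k, g k =ᵐ[μ] g' k := by
  obtain ⟨hm, E, hE, h⟩ := hg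
  refine ⟨fun k => (hm k).mk, ⟨fun k => (hm k).measurable_mk.aemeasurable,
    E ∪ {x | ¬∀ k, g k x = (hm k).mk (g k) x}, ?_, ?_⟩, fun k => (hm k).measurable_mk,
    fun k => (hm k).ae_eq_mk⟩
  · exact measure_union_null hE (ae_all_iff.2 fun k => (hm k).ae_eq_mk)
  · intro k x y hx hy h1 h2
    simp only [mem_union, mem_ofPred_eq, not_or, not_not] at hx hy
    beta_reduce
    rw [← hx.2 k, ← hy.2 k]
    exact h k x y hx.1 hy.1 h1 h2

theorem IsFracHajlaszGradient.ae_eq_const [BorelSpace X] (hμ : IsDoublingSpace μ) {p : ℝ}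
    (hp : 1 < p) (hP : SupportsWeakPoincare μ p) {u : X → ℝ} (hu : AEMeasurable u μ)
    {g : ℤ → X → ℝ≥0} (hg : IsFracHajlaszGradient μ 1 u g)
    (hlim : Tendsto (fun k => ∫⁻ x, (g k x : ℝ≥0∞) ^ p ∂μ) atTop (𝓝 0)) :
    ∃ c : ℝ, u =ᵐ[μ] fun _ => c := by
  have hp0 : 0 < p := by linarith
  have hsc := hμ.secondCountableTopology
  obtain ⟨g', ⟨-, E, hE, hgE⟩, hg'm, hgg'⟩ := hg.exists_measurable
  have hlim' : Tendsto (fun k => ∫⁻ x, (g' k x : ℝ≥0∞) ^ p ∂μ) atTop (𝓝 0) := by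
    refine hlim.congr fun k => lintegral_congr_ae ?_
    filter_upwards [hgg' k] with x hx
    rw [hx]
  -- `u` need not be locally integrable. As `arctan` is bounded, 1-Lipschitz and injective, `arctan
  -- u` is bounded with the same gradient, and `tan` recovers `u`.
  have hatan : AEStronglyMeasurable (fun x => Real.arctan (u x)) μ :=
    (Real.continuous_arctan.measurable.comp_aemeasurable hu).aestronglyMeasurable
  obtain ⟨c, hc⟩ := hP.ae_eq_const_of_bounded hμ hp (u := fun x => Real.arctan (u x))
    (M := Real.pi / 2) hatan
    (fun y => abs_le.2 ⟨(Real.neg_pi_div_two_lt_arctan _).le, (Real.arctan_lt_pi_div_two _).le⟩)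
    fun ε hε => by
      -- The threshold `ε / 2` absorbs the factor `2` lost in the tail; `k ≥ 0` ensures `r ≤ 1`.
      obtain ⟨k, hk, hk0⟩ := ((eventually_forall_ge_atTop.2
        (ENNReal.tendsto_nhds_zero.1 hlim' (ε / 2) (by simpa [pos_iff_ne_zero] using hε))).and (eventually_ge_atTop 0)).exists
      have h2k : (0 : ℝ) < (2 : ℝ) ^ (-k) := by positivity
      have h8 : 8 * ((2 : ℝ) ^ (-k) / 8) = (2 : ℝ) ^ (-k) := by ring
      refine ⟨(2 : ℝ) ^ (-k) / 8, weightedTail p g' k, E, by positivity, ?_,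
        measurable_weightedTail hg'm k, ?_, hE, fun y z hy hz hyz => ?_⟩
      · have : (2 : ℝ) ^ (-k) ≤ 1 := zpow_le_one_of_nonpos₀ one_le_two (by omega)
        linarith
      · refine (lintegral_weightedTail_rpow_le hp hg'm hk).trans_eq ?_
        exact ENNReal.mul_div_cancel (by simp) (by simp)
      · rw [h8] at hyz ⊢
        refine enorm_sub_le_weightedTail hp0 (u := fun x => Real.arctan (u x))
          (fun k x y hx hy h1 h2 => ?_) k hy hz hyz
        refine (Real.abs_arctan_sub_arctan_le _ _).trans ?_
        simpa using hgE k x y hx hy h1 h2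
  refine ⟨Real.tan c, ?_⟩
  filter_upwards [hc] with x hx
  rw [← hx, Real.tan_arctan]

end Hajlasz

theorem theorem4p1 {X : Type*} [MetricSpace X] [MeasurableSpace X] [BorelSpace X]
    (μ : Measure X) (hμ : IsDoublingSpace μ) (p : ℝ) (hp : 1 < p)
    (hP : SupportsWeakPoincare μ p) (q : ℝ) (hq : 0 < q) :
    (∀ u ∈ hajlaszBesov μ 1 p q,
      ∃ c : ℝ, u =ᵐ[μ] fun _ => c) ∧
    (∀ u ∈ hajlaszTriebelLizorkin μ 1 p q,
      ∃ c : ℝ, u =ᵐ[μ] fun _ => c) := by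
  have hp0 : 0 < p := by linarith
  constructor
  · rintro u ⟨hu, h⟩
    simp only [hajlaszBesovSeminorm, iInf_lt_iff] at h
    obtain ⟨g, hg, hfin⟩ := h
    exact hg.ae_eq_const hμ hp hP hu (tendsto_lintegral_rpow_of_lqLpNorm_lt_top hp0 hq hfin)
  · rintro u ⟨hu, h⟩
    simp only [hajlaszTriebelLizorkinSeminorm, iInf_lt_iff] at h
    obtain ⟨g, hg, hfin⟩ := h
    exact hg.ae_eq_const hμ hp hP hu
      (tendsto_lintegral_rpow_of_lpLqNorm_lt_top hp0 hq hg.1 hfin)
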